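/- Let $G$ be a group with identity $e$. A $G$-automaton over a finite alphabet $\Sigma$ consists of a finite state set $Q$, an initial state $q_0\in Q$, a set $Q_a\subseteq Q$ of accepting states, and a transition function $\delta$ assigning to each pair in $Q\times(\Sigma\cup\{\varepsilon\})$ a finite subset of $Q\times G$. It starts in $q_0$ with register content $e$. When it is in state $q$ with register content $x$, for any $(q',m)\in\delta(q,\sigma)$ it may read $\sigma$ (a letter, or the empty word), move to $q'$ and replace $x$ by $xm$. A word $w\in\Sigma^*$ is accepted if some computation reads all of $w$ and ends in an accepting state with register content $e$. Let $\mathfrak{L}(G)$ be the class of languages over finite alphabets recognized by $G$-automata, let $\mathsf{RE}$ be the class of recursively enumerable languages over finite alphabets, and let $\mathbf{F}_2$ be the free group of rank $2$. **Theorem.** For every integer $n\ge 4$, $$\mathsf{RE}=\mathfrak{L}(\mathbf{F}_2\times\mathbf{F}_2)=\mathfrak{L}(SL(n,\mathbb{Z})).$$ -/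

import Mathlib

/-- A group automaton (extended finite automaton) over the group `G` with input alphabet `A` and
state set `Q`.  The transition function sends a state and an input letter (`some a`) or the empty
word (`none`) to a *finite* set of pairs (next state, group element multiplied to the register). -/
structure GroupAutomaton (G A Q : Type*) [Group G] where
  step : Q → Option A → Finset (Q × G)
  start : Q
  accept : Set Q

namespace GroupAutomaton

/-- A configuration: the current state, the part of the input not yet read, the register. -/
structure Config (G A Q : Type*) where
  state : Q
  input : List A
  register : G

section

variable {G A Q : Type*} [Group G] (E : GroupAutomaton G A Q)

/-- One computation step: either a letter is read, or an empty-word transition is taken.  In both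
cases the old register content `x` is replaced by `x * m`. -/
inductive Move : Config G A Q → Config G A Q → Prop
  | read {q q' : Q} {a : A} {w : List A} {x m : G} (h : (q', m) ∈ E.step q (some a)) :
      Move ⟨q, a :: w, x⟩ ⟨q', w, x * m⟩
  | eps {q q' : Q} {w : List A} {x m : G} (h : (q', m) ∈ E.step q none) :
      Move ⟨q, w, x⟩ ⟨q', w, x * m⟩

/-- The language recognized by `E`: the words `w` for which some computation, started in the
initial state with register `1`, reads all of `w` and ends in an accepting state with
register `1`. -/
def recognized : Language A :=
  {w | ∃ q ∈ E.accept, Relation.ReflTransGen E.Move ⟨E.start, w, 1⟩ ⟨q, [], 1⟩}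

end

end GroupAutomaton

/-- The languages over the alphabet `A` that are recognized by `G`-automata with finitely many
states.  (Up to renaming, every finite state set lives in `Type`.) -/
def groupAutomatonLanguages (G : Type*) [Group G] (A : Type*) : Set (Language A) :=
  {L | ∃ (Q : Type) (_ : Finite Q) (E : GroupAutomaton G A Q), E.recognized = L}

/-- The recursively enumerable languages over the finite alphabet `A`: after numbering the letters
of `A` as `0, …, k - 1`, membership is a recursively enumerable predicate of words over `Fin k`.
The choice of numbering is irrelevant, see `mem_reLanguages_iff_forall`. -/
def reLanguages (A : Type*) : Set (Language A) :=
  {L | ∃ (k : ℕ) (e : A ≃ Fin k), REPred fun w : List (Fin k) => w.map e.symm ∈ L}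

/-- Any numbering of the letters may be used to test recursive enumerability. -/
theorem mem_reLanguages_iff_forall {A : Type*} [Finite A] (L : Language A) :
    L ∈ reLanguages A ↔
      ∀ (k : ℕ) (e : A ≃ Fin k), REPred fun w : List (Fin k) => w.map e.symm ∈ L := by
  constructor
  · rintro ⟨k, e, h⟩ k' e'
    have hf : Computable fun w : List (Fin k') => w.map (fun i => e (e'.symm i)) :=
      (Primrec.list_map Primrec.id
        ((Primrec.dom_finite fun i : Fin k' => e (e'.symm i)).comp Primrec.snd).to₂).to_comp
    have h2 : Partrec fun w : List (Fin k') =>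
        Part.assert ((w.map (fun i => e (e'.symm i))).map e.symm ∈ L) fun _ => Part.some () :=
      Partrec.comp h hf
    exact REPred.of_eq h2 fun w => by simp [Function.comp_def]
  · intro h
    obtain ⟨k, ⟨e⟩⟩ := Finite.exists_equiv_fin A
    exact ⟨k, e, h k e⟩

/-! The classes form a cycle of inclusions RE ⊆ 𝔏(F₂ × F₂) ⊆ 𝔏(SL(n,ℤ)) ⊆ RE. The middle one
transports registers along an injective homomorphism: ping-pong embeds F₂ in SL(2,ℤ), and two
diagonal blocks embed F₂ × F₂ in SL(4,ℤ), hence in SL(n,ℤ). The last one holds because an accepting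
computation is a finite list of transitions, and it is primitive recursive to check that such a list
is composable, reads the given word and multiplies to 1.

The substance is RE ⊆ 𝔏(F₂ × F₂). Finitely generated free monoids embed in F₂, so the register can
hold two growing words and test them for equality by cancelling a guessed common word
(`recognized_toGroupAutomaton`). Let the first word log everything taken from a queue and the second
everything put into it; equality of the logs then enforces the queue discipline, provided that
removals never overtake insertions.

One queue is enough for universal computation. The four stacks of a `TM2` machine are written as one
cyclic word in which stack names serve as markers; rotating the queue brings any stack to the front,
where a push, peek or pop is a local rewriting. Acceptance then means halting
(`mem_language_simulation`), and every recursively enumerable language is a halting set of such a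
machine, by way of `REPred.exists_code`. -/

/-! ### Runs of group automata and change of group -/

namespace GroupAutomaton

variable {G H A Q : Type*} [Group G] [Group H]

/-- `E.Run q w g q'`: some computation path leads from `q` to `q'`, reads `w`, and multiplies the
register by `g`. -/
inductive Run (E : GroupAutomaton G A Q) : Q → List A → G → Q → Prop
  | refl (q : Q) : Run E q [] 1 q
  | step {q q₁ q' : Q} {o : Option A} {m g : G} {w : List A} (h : (q₁, m) ∈ E.step q o)
      (hr : Run E q₁ w g q') : Run E q (o.toList ++ w) (m * g) q'

theorem Run.reflTransGen {E : GroupAutomaton G A Q} {q q' : Q} {w : List A} {g : G}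
    (h : E.Run q w g q') (x : G) :
    Relation.ReflTransGen E.Move ⟨q, w, x⟩ ⟨q', [], x * g⟩ := by
  induction h generalizing x with
  | refl q => rw [mul_one]
  | @step q q₁ q' o m g w h _ ih =>
    rw [← mul_assoc]
    refine Relation.ReflTransGen.head ?_ (ih (x * m))
    cases o with
    | none => exact Move.eps h
    | some a => exact Move.read h

theorem exists_run_of_reflTransGen {E : GroupAutomaton G A Q} {c d : Config G A Q}
    (h : Relation.ReflTransGen E.Move c d) (hd : d.input = []) :
    ∃ g, E.Run c.state c.input g d.state ∧ d.register = c.register * g := by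
  induction h using Relation.ReflTransGen.head_induction_on with
  | refl => exact ⟨1, hd ▸ Run.refl _, (mul_one _).symm⟩
  | head h _ ih =>
    obtain ⟨g, hg, hr⟩ := ih
    cases h with
    | @read q q' a w x m h =>
      exact ⟨m * g, Run.step (o := some a) h hg, by rw [hr, mul_assoc]⟩
    | @eps q q' w x m h =>
      exact ⟨m * g, Run.step (o := none) h hg, by rw [hr, mul_assoc]⟩

theorem mem_recognized_iff {E : GroupAutomaton G A Q} {w : List A} :
    w ∈ E.recognized ↔ ∃ q ∈ E.accept, E.Run E.start w 1 q := by
  constructor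
  · rintro ⟨q, hq, h⟩
    obtain ⟨g, hg, h1⟩ := exists_run_of_reflTransGen h rfl
    obtain rfl : g = 1 := by simpa using h1.symm
    exact ⟨q, hq, hg⟩
  · rintro ⟨q, hq, h⟩
    exact ⟨q, hq, by simpa using h.reflTransGen 1⟩

/-- Apply a homomorphism to all register updates. -/
noncomputable def map (E : GroupAutomaton G A Q) (φ : G →* H) : GroupAutomaton H A Q where
  step q o := by
    classical exact (E.step q o).image fun p => (p.1, φ p.2)
  start := E.start
  accept := E.accept

theorem run_map_iff {E : GroupAutomaton G A Q} {φ : G →* H} {q q' : Q} {w : List A} {h : H} :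
    (E.map φ).Run q w h q' ↔ ∃ g, E.Run q w g q' ∧ φ g = h := by
  constructor
  · intro hr
    induction hr with
    | refl q => exact ⟨1, Run.refl q, map_one φ⟩
    | step h _ ih =>
      obtain ⟨g, hg, rfl⟩ := ih
      simp only [map, Finset.mem_image, Prod.mk.injEq, Prod.exists] at h
      obtain ⟨q₁, m, hm, rfl, rfl⟩ := h
      exact ⟨m * g, Run.step hm hg, map_mul φ m g⟩
  · rintro ⟨g, hg, rfl⟩
    induction hg with
    | refl q => rw [map_one]; exact Run.refl q
    | @step q q₁ q' o m g w h _ ih =>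
      rw [map_mul]
      refine Run.step ?_ ih
      simp only [map, Finset.mem_image]
      exact ⟨_, h, rfl⟩

/-- Injectivity ensures that the image register returns to 1 only when the original one does. -/
theorem recognized_map (E : GroupAutomaton G A Q) {φ : G →* H} (hφ : Function.Injective φ) :
    (E.map φ).recognized = E.recognized := by
  ext w
  simp only [mem_recognized_iff, run_map_iff, map_eq_one_iff φ hφ, exists_eq_right]
  rfl

end GroupAutomaton

theorem groupAutomatonLanguages_mono {G H : Type*} [Group G] [Group H] (φ : G →* H)
    (hφ : Function.Injective φ) (A : Type*) :
    groupAutomatonLanguages G A ⊆ groupAutomatonLanguages H A := by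
  rintro L ⟨Q, hQ, E, rfl⟩
  exact ⟨Q, hQ, E.map φ, E.recognized_map hφ⟩

/-! ### F₂ × F₂ inside SL(n,ℤ) -/

section Embedding

open Matrix

/-- The unipotent matrices `!![1, 3; 0, 1]` and `!![1, 0; 3, 1]`. -/
def sanovGenerator : Fin 2 → SpecialLinearGroup (Fin 2) ℤ :=
  ![⟨!![1, 3; 0, 1], by simp⟩, ⟨!![1, 0; 3, 1], by simp⟩]

/-- Ping-pong for `!![1, 3; 0, 1]` acting on a nonzero column `(x, y)`. If the signs differ and `|x|
≤ |y|`, then `|x + 3y| ≥ 2|y| > |y|`. With 2 in place of 3, the boundary vector `(-1, 1)` would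
violate the strict inequality. -/
theorem sanov_attract {x y : ℤ} (h0 : x ≠ 0 ∨ y ≠ 0) (h : ¬(y ^ 2 < x ^ 2 ∧ x * y < 0)) :
    y ^ 2 < (x + 3 * y) ^ 2 ∧ 0 ≤ (x + 3 * y) * y := by
  have h0' : 0 < x ^ 2 ∨ 0 < y ^ 2 := h0.imp (fun h => by positivity) (fun h => by positivity)
  rcases lt_or_ge (x * y) 0 with hxy | hxy
  · have h1 : x ^ 2 ≤ y ^ 2 := by
      by_contra h2
      exact h ⟨not_le.1 h2, hxy⟩
    have h2 : 0 < y ^ 2 := h0'.elim (fun h => h.trans_le h1) id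
    constructor <;> nlinarith [sq_nonneg (x + y)]
  · constructor
    · rcases h0' with h0' | h0' <;> nlinarith [sq_nonneg x, sq_nonneg y]
    · nlinarith [sq_nonneg y]

theorem sanov_repel {x y : ℤ} (h0 : x ≠ 0 ∨ y ≠ 0) (h : ¬(y ^ 2 < x ^ 2 ∧ 0 ≤ x * y)) :
    y ^ 2 < (x - 3 * y) ^ 2 ∧ (x - 3 * y) * y < 0 := by
  have h0' : 0 < x ^ 2 ∨ 0 < y ^ 2 := h0.imp (fun h => by positivity) (fun h => by positivity)
  rcases lt_or_ge (x * y) 0 with hxy | hxy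
  · have hy : 0 < y ^ 2 := by
      have : y ≠ 0 := by rintro rfl; simp at hxy
      positivity
    constructor <;> nlinarith [sq_nonneg x]
  · have h1 : x ^ 2 ≤ y ^ 2 := by
      by_contra h2
      exact h ⟨not_le.1 h2, hxy⟩
    have h2 : 0 < y ^ 2 := h0'.elim (fun h => h.trans_le h1) id
    constructor <;> nlinarith [sq_nonneg (x - y)]

/-- Ping-pong on SL(2,ℤ) itself under left multiplication, with regions that depend only on the
first column. That column is nonzero because the determinant is 1, so the origin needs no separate
treatment. The second generator is the first with the coordinates exchanged. -/
theorem sanov_injective : Function.Injective (FreeGroup.lift sanovGenerator) := by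
  have hcol (g : SpecialLinearGroup (Fin 2) ℤ) : g.1 0 0 ≠ 0 ∨ g.1 1 0 ≠ 0 := by
    by_contra! h
    have := g.2
    rw [det_fin_two, h.1, h.2] at this
    simp at this
  refine FreeGroup.injective_lift_of_ping_pong sanovGenerator
    (α := SpecialLinearGroup (Fin 2) ℤ)
    (fun i => {g | (g.1 (1 - i) 0) ^ 2 < (g.1 i 0) ^ 2 ∧ 0 ≤ g.1 i 0 * g.1 (1 - i) 0})
    (fun i => {g | (g.1 (1 - i) 0) ^ 2 < (g.1 i 0) ^ 2 ∧ g.1 i 0 * g.1 (1 - i) 0 < 0})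
    ?_ ?_ ?_ ?_ ?_ ?_
  · intro i
    fin_cases i
    · exact ⟨1, by simp⟩
    · exact ⟨⟨!![0, -1; 1, 0], by simp⟩, by change (0 : ℤ) ^ 2 < 1 ^ 2 ∧ 0 ≤ (1 : ℤ) * 0; simp⟩
  · intro i j hij
    rw [Function.onFun, Set.disjoint_left]
    fin_cases i <;> fin_cases j <;> simp at hij ⊢ <;> intros <;> linarith
  · intro i j hij
    rw [Function.onFun, Set.disjoint_left]
    fin_cases i <;> fin_cases j <;> simp at hij ⊢ <;> intros <;> linarith
  · intro i j
    rw [Set.disjoint_left]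
    fin_cases i <;> fin_cases j <;> simp <;> intros <;> linarith
  · rintro i _ ⟨g, hg, rfl⟩
    fin_cases i
    · change (((sanovGenerator 0).1 * g.1) 1 0) ^ 2 < (((sanovGenerator 0).1 * g.1) 0 0) ^ 2 ∧
        0 ≤ ((sanovGenerator 0).1 * g.1) 0 0 * ((sanovGenerator 0).1 * g.1) 1 0
      simpa [sanovGenerator, Matrix.mul_apply] using sanov_attract (hcol g) hg
    · change (((sanovGenerator 1).1 * g.1) 0 0) ^ 2 < (((sanovGenerator 1).1 * g.1) 1 0) ^ 2 ∧
        0 ≤ ((sanovGenerator 1).1 * g.1) 1 0 * ((sanovGenerator 1).1 * g.1) 0 0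
      simpa [sanovGenerator, Matrix.mul_apply, add_comm] using sanov_attract (hcol g).symm hg
  · rintro i _ ⟨g, hg, rfl⟩
    fin_cases i
    -- The inverse in the special linear group is the adjugate.
    · change ((adjugate (sanovGenerator 0).1 * g.1) 1 0) ^ 2 <
          ((adjugate (sanovGenerator 0).1 * g.1) 0 0) ^ 2 ∧
        (adjugate (sanovGenerator 0).1 * g.1) 0 0 * (adjugate (sanovGenerator 0).1 * g.1) 1 0 < 0
      simpa [sanovGenerator, Matrix.mul_apply, adjugate_fin_two, sub_eq_add_neg] using sanov_repel (hcol g) hg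
    · change ((adjugate (sanovGenerator 1).1 * g.1) 0 0) ^ 2 <
          ((adjugate (sanovGenerator 1).1 * g.1) 1 0) ^ 2 ∧
        (adjugate (sanovGenerator 1).1 * g.1) 1 0 * (adjugate (sanovGenerator 1).1 * g.1) 0 0 < 0
      simpa [sanovGenerator, Matrix.mul_apply, adjugate_fin_two, sub_eq_add_neg, add_comm]
        using sanov_repel (hcol g).symm hg

/-- Block diagonal embedding of `SL(m) × SL(n)`. -/
def Matrix.SpecialLinearGroup.blockDiag {m n R : Type*} [Fintype m] [Fintype n] [DecidableEq m]
    [DecidableEq n] [CommRing R] :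
    SpecialLinearGroup m R × SpecialLinearGroup n R →* SpecialLinearGroup (m ⊕ n) R where
  toFun p := ⟨fromBlocks p.1 0 0 p.2, by simp⟩
  map_one' := by ext : 1; simp
  map_mul' p q := Subtype.ext <| by
    change fromBlocks (p.1.1 * q.1.1) 0 0 (p.2.1 * q.2.1) =
      fromBlocks p.1.1 0 0 p.2.1 * fromBlocks q.1.1 0 0 q.2.1
    simp [fromBlocks_multiply]

theorem Matrix.SpecialLinearGroup.blockDiag_injective {m n R : Type*} [Fintype m] [Fintype n]
    [DecidableEq m] [DecidableEq n] [CommRing R] :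
    Function.Injective (blockDiag (m := m) (n := n) (R := R)) := by
  intro p q h
  have h' : fromBlocks p.1.1 0 0 p.2.1 = fromBlocks q.1.1 0 0 q.2.1 := congrArg Subtype.val h
  rw [fromBlocks_inj] at h'
  exact Prod.ext (Subtype.ext h'.1) (Subtype.ext h'.2.2.2)

/-- Renaming the indices of a special linear group. -/
def Matrix.SpecialLinearGroup.reindexHom {m n R : Type*} [Fintype m] [Fintype n] [DecidableEq m]
    [DecidableEq n] [CommRing R] (e : m ≃ n) :
    SpecialLinearGroup m R →* SpecialLinearGroup n R where
  toFun p := ⟨reindex e e p.1, by simp⟩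
  map_one' := Subtype.ext <| by
    change reindex e e (1 : Matrix m m R) = 1
    simp
  map_mul' p q := Subtype.ext <| by
    change reindex e e (p.1 * q.1) = reindex e e p.1 * reindex e e q.1
    simp

theorem Matrix.SpecialLinearGroup.reindexHom_injective {m n R : Type*} [Fintype m] [Fintype n]
    [DecidableEq m] [DecidableEq n] [CommRing R] (e : m ≃ n) :
    Function.Injective (reindexHom (R := R) e) := fun _ _ h =>
  Subtype.ext ((reindex e e).injective (congrArg Subtype.val h))

theorem exists_freeGroup_prod_embedding {n : ℕ} (hn : 4 ≤ n) :
    ∃ φ : FreeGroup (Fin 2) × FreeGroup (Fin 2) →* SpecialLinearGroup (Fin n) ℤ,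
      Function.Injective φ := by
  -- Two blocks of size 2 carry the free groups; the remaining `n - 4` coordinates carry an identity
  -- block.
  have e : ((Fin 2 ⊕ Fin 2) ⊕ Fin (n - 4)) ≃ Fin n :=
    Fintype.equivFinOfCardEq (by simp; omega)
  let ψ := FreeGroup.lift sanovGenerator
  refine ⟨(SpecialLinearGroup.reindexHom e).comp
    (SpecialLinearGroup.blockDiag.comp ((MonoidHom.inl _ _).comp
      (SpecialLinearGroup.blockDiag.comp (ψ.prodMap ψ)))), ?_⟩
  simp only [MonoidHom.coe_comp, MonoidHom.coe_prodMap]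
  refine (SpecialLinearGroup.reindexHom_injective e).comp (SpecialLinearGroup.blockDiag_injective.comp
    (Function.Injective.comp (fun x y h => (Prod.ext_iff.1 h).1)
      (SpecialLinearGroup.blockDiag_injective.comp ?_)))
  exact sanov_injective.prodMap sanov_injective

end Embedding

/-! ### Primitive recursion tools -/

section PrimitiveRecursion

/-- Unbounded search over codes of elements of `β`; a number that decodes to nothing counts as a
failed test. -/
theorem REPred.exists_of_primrecPred {α β : Type*} [Primcodable α] [Primcodable β]
    {P : α → β → Prop} (hP : PrimrecPred fun p : α × β => P p.1 p.2) :
    REPred fun a => ∃ b, P a b := by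
  obtain ⟨hdec, hP⟩ := hP
  let _ : ∀ a b, Decidable (P a b) := fun a b => hdec (a, b)
  let c : α → ℕ → Bool := fun a n =>
    Option.casesOn (Encodable.decode (α := β) n) false fun b => decide (P a b)
  have hc : Primrec₂ c := by
    refine Primrec.option_casesOn (Primrec.decode.comp Primrec.snd) (Primrec.const false) ?_
    have h : Primrec fun p : (α × ℕ) × β => decide (P p.1.1 p.2) :=
      hP.comp (Primrec.pair (Primrec.fst.comp Primrec.fst) Primrec.snd)
    exact h
  have h : Partrec fun a => Nat.rfind fun n => Part.some (c a n) :=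
    Partrec.rfind hc.to_comp.partrec₂
  refine h.dom_re.of_eq fun a => Nat.rfind_dom.trans ?_
  constructor
  · rintro ⟨n, hn, -⟩
    rw [Part.mem_some_iff] at hn
    simp only [c] at hn
    cases hd : Encodable.decode (α := β) n with
    | none => simp [hd] at hn
    | some b => exact ⟨b, by simpa [hd] using hn⟩
  · rintro ⟨b, hb⟩
    exact ⟨Encodable.encode b, by simp [c, hb], fun _ => trivial⟩

theorem Primrec.fin_fun {α σ : Type*} [Primcodable α] [Primcodable σ] {n : ℕ} {f : α → Fin n → σ}
    (h : ∀ i, Primrec fun a => f a i) : Primrec f :=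
  Primrec.fin_curry.2 (Primrec.fin_curry₁ (f := fun i a => f a i) |>.2 h).swap

theorem Primrec.fin_fun_apply {α σ : Type*} [Primcodable α] [Primcodable σ] {n : ℕ}
    {f : α → Fin n → σ} (h : Primrec f) (i : Fin n) : Primrec fun a => f a i :=
  (Primrec.fin_curry.1 h).comp Primrec.id (Primrec.const i)

theorem Primrec.fin_sum {α : Type*} [Primcodable α] {n : ℕ} {f : Fin n → α → ℕ}
    (h : ∀ i, Primrec (f i)) : Primrec fun a => ∑ i, f i a := by
  induction n with
  | zero => simpa using Primrec.const 0
  | succ n ih =>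
    simp only [Fin.sum_univ_succ]
    exact Primrec.nat_add.comp (h 0) (ih fun i => h i.succ)

end PrimitiveRecursion

/-! ### The word problem of SL(n,ℤ) -/

section WordProblem

open Matrix

/-- Multiplication by the integer matrix `m t`, on integer matrices represented as differences of
matrices with entries in `ℕ`. -/
def signedStep {T : Type*} {n : ℕ} (m : T → Matrix (Fin n) (Fin n) ℤ)
    (p : ((Fin n → Fin n → ℕ) × (Fin n → Fin n → ℕ)) × T) :
    (Fin n → Fin n → ℕ) × (Fin n → Fin n → ℕ) :=
  (fun i j => ∑ k, (p.1.1 i k * (m p.2 k j).toNat + p.1.2 i k * (-m p.2 k j).toNat),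
   fun i j => ∑ k, (p.1.1 i k * (-m p.2 k j).toNat + p.1.2 i k * (m p.2 k j).toNat))

/-- The product of a list of integer matrices, represented as a difference of matrices with
entries in `ℕ`. -/
def signedProd {T : Type*} {n : ℕ} (m : T → Matrix (Fin n) (Fin n) ℤ) (ts : List T) :
    (Fin n → Fin n → ℕ) × (Fin n → Fin n → ℕ) :=
  ts.foldl (fun s t => signedStep m (s, t)) (fun i j => if i = j then 1 else 0, fun _ _ => 0)

theorem signedProd_sub {T : Type*} {n : ℕ} (m : T → Matrix (Fin n) (Fin n) ℤ) (ts : List T)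
    (i j : Fin n) :
    ((signedProd m ts).1 i j : ℤ) - (signedProd m ts).2 i j = (ts.map m).prod i j := by
  induction ts using List.reverseRecOn generalizing j with
  | nil =>
    simp [signedProd, Matrix.one_apply]
  | append_singleton ts t ih =>
    rw [List.map_append, List.prod_append, List.map_singleton, List.prod_singleton,
      Matrix.mul_apply]
    simp only [← ih]
    simp only [signedProd, List.foldl_append, List.foldl_cons, List.foldl_nil,
      signedStep]
    push_cast
    rw [← Finset.sum_sub_distrib]
    refine Finset.sum_congr rfl fun k _ => ?_
    conv_rhs => rw [← Int.toNat_sub_toNat_neg (m t k j)]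
    ring

theorem primrec_signedStep {T : Type*} [Finite T] [Primcodable T] {n : ℕ}
    (m : T → Matrix (Fin n) (Fin n) ℤ) : Primrec (signedStep m) := by
  have h1 (i k : Fin n) : Primrec fun p :
      ((Fin n → Fin n → ℕ) × (Fin n → Fin n → ℕ)) × T => p.1.1 i k :=
    ((Primrec.fst.comp Primrec.fst).fin_fun_apply i).fin_fun_apply k
  have h2 (i k : Fin n) : Primrec fun p :
      ((Fin n → Fin n → ℕ) × (Fin n → Fin n → ℕ)) × T => p.1.2 i k :=
    ((Primrec.snd.comp Primrec.fst).fin_fun_apply i).fin_fun_apply k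
  have h3 (f : T → ℕ) : Primrec fun p :
      ((Fin n → Fin n → ℕ) × (Fin n → Fin n → ℕ)) × T => f p.2 :=
    (Primrec.dom_finite f).comp Primrec.snd
  have h4 (f g : Fin n → Fin n → T → ℕ) : Primrec fun p :
      ((Fin n → Fin n → ℕ) × (Fin n → Fin n → ℕ)) × T => fun i j =>
        ∑ k, (p.1.1 i k * f k j p.2 + p.1.2 i k * g k j p.2) :=
    Primrec.fin_fun fun i => Primrec.fin_fun fun j => Primrec.fin_sum fun k =>
      Primrec.nat_add.comp (Primrec.nat_mul.comp (h1 i k) (h3 (f k j)))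
        (Primrec.nat_mul.comp (h2 i k) (h3 (g k j)))
  exact Primrec.pair (h4 (fun k j t => (m t k j).toNat) (fun k j t => (-m t k j).toNat))
    (h4 (fun k j t => (-m t k j).toNat) (fun k j t => (m t k j).toNat))

theorem primrec_signedProd {T : Type*} [Finite T] [Primcodable T] {n : ℕ}
    (m : T → Matrix (Fin n) (Fin n) ℤ) : Primrec (signedProd m) :=
  Primrec.list_foldl Primrec.id (Primrec.const _) ((primrec_signedStep m).comp Primrec.snd).to₂

theorem primrecPred_prod_eq_one {T : Type*} [Finite T] [Primcodable T] {n : ℕ}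
    (g : T → SpecialLinearGroup (Fin n) ℤ) :
    PrimrecPred fun ts : List T => (ts.map g).prod = 1 := by
  have hs := primrec_signedProd fun t => (g t).1
  -- For a product represented as `P - N`, being the identity is the equation `P = N + 1` of
  -- matrices over ℕ.
  have h : PrimrecPred fun ts : List T => (signedProd (fun t => (g t).1) ts).1 =
      fun i j => (signedProd (fun t => (g t).1) ts).2 i j + if i = j then 1 else 0 := by
    refine Primrec.eq.comp (Primrec.fst.comp hs)
      (Primrec.fin_fun fun i => Primrec.fin_fun fun j => ?_)
    exact Primrec.nat_add.comp (((Primrec.snd.comp hs).fin_fun_apply i).fin_fun_apply j)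
      (Primrec.const _)
  refine h.of_eq fun ts => ?_
  have hval : ((ts.map g).prod).1 = (ts.map fun t => (g t).1).prod := by
    induction ts with
    | nil => rfl
    | cons t ts ih => rw [List.map_cons, List.prod_cons, List.map_cons, List.prod_cons, ← ih]; rfl
  refine Iff.trans ?_ Subtype.ext_iff.symm
  rw [hval, funext_iff, ← Matrix.ext_iff]
  refine forall_congr' fun i => ?_
  rw [funext_iff]
  refine forall_congr' fun j => ?_
  rw [← signedProd_sub]
  change _ ↔ _ = (1 : Matrix (Fin n) (Fin n) ℤ) i j
  rw [Matrix.one_apply]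
  split_ifs <;> omega

end WordProblem

/-! ### SL(n,ℤ)-automata recognize recursively enumerable languages -/

namespace GroupAutomaton

variable {G A Q : Type*} [Group G]

/-- The transitions of a group automaton. -/
abbrev Transition (E : GroupAutomaton G A Q) : Type _ :=
  {t : Q × Option A × Q × G // t.2.2 ∈ E.step t.1 t.2.1}

instance [Finite Q] [Finite A] (E : GroupAutomaton G A Q) : Finite E.Transition := by
  let f : E.Transition → Σ p : Q × Option A, {x // x ∈ E.step p.1 p.2} :=
    fun t => ⟨(t.1.1, t.1.2.1), ⟨t.1.2.2, t.2⟩⟩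
  refine Finite.of_injective f ?_
  rintro ⟨⟨q, o, p⟩, h⟩ ⟨⟨q', o', p'⟩, h'⟩ heq
  simp only [f, Sigma.mk.injEq, Prod.mk.injEq] at heq
  obtain ⟨⟨rfl, rfl⟩, heq⟩ := heq
  simp only [heq_eq_eq, Subtype.mk.injEq] at heq
  subst heq
  rfl

/-- The state reached by following a list of transitions, if they are composable. -/
def follow [DecidableEq Q] (E : GroupAutomaton G A Q) (s : Option Q) (ts : List E.Transition) :
    Option Q :=
  ts.foldl (fun s t => if s = some t.1.1 then some t.1.2.2.1 else none) s

theorem follow_none [DecidableEq Q] (E : GroupAutomaton G A Q) (ts : List E.Transition) :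
    E.follow none ts = none := by
  induction ts with
  | nil => rfl
  | cons t ts ih => simpa [follow] using ih

/-- This turns runs into lists over a type that is finite when `Q` and `A` are, so that they can be
enumerated and checked. -/
theorem run_iff_exists_follow [DecidableEq Q] {E : GroupAutomaton G A Q} {q q' : Q} {w : List A}
    {g : G} :
    E.Run q w g q' ↔ ∃ ts : List E.Transition, E.follow (some q) ts = some q' ∧
      ts.filterMap (fun t => t.1.2.1) = w ∧ (ts.map fun t => t.1.2.2.2).prod = g := by
  constructor
  · intro h
    induction h with
    | refl q => exact ⟨[], rfl, rfl, rfl⟩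
    | @step q q₁ q' o m g w h _ ih =>
      obtain ⟨ts, h1, h2, h3⟩ := ih
      refine ⟨⟨(q, o, q₁, m), h⟩ :: ts, by simpa [follow] using h1, ?_, by simp [h3]⟩
      rw [List.filterMap_cons]
      cases o <;> simp [h2]
  · rintro ⟨ts, h1, rfl, rfl⟩
    induction ts generalizing q with
    | nil =>
      obtain rfl : q = q' := by simpa [follow] using h1
      exact Run.refl q
    | cons t ts ih =>
      obtain ⟨⟨p, o, q₁, m⟩, h⟩ := t
      by_cases hp : q = p
      · subst hp
        have := Run.step h (ih (q := q₁) (by simpa [follow] using h1))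
        cases o <;> simpa [List.filterMap_cons] using this
      · rw [show E.follow (some q) (⟨(p, o, q₁, m), h⟩ :: ts) = E.follow none ts by
          simp [follow, hp], follow_none] at h1
        cases h1

end GroupAutomaton

theorem specialLinearGroup_languages_subset (n : ℕ) (A : Type*) [Finite A] :
    groupAutomatonLanguages (Matrix.SpecialLinearGroup (Fin n) ℤ) A ⊆ reLanguages A := by
  classical
  rintro L ⟨Q, hQ, E, rfl⟩
  obtain ⟨k, ⟨e⟩⟩ := Finite.exists_equiv_fin A
  refine ⟨k, e, ?_⟩
  obtain ⟨N, ⟨eT⟩⟩ := Finite.exists_equiv_fin E.Transition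
  obtain ⟨r, ⟨eQ⟩⟩ := Finite.exists_equiv_fin Q
  let _ : Primcodable E.Transition := Primcodable.ofEquiv _ eT
  let _ : Primcodable Q := Primcodable.ofEquiv _ eQ
  have hpath : PrimrecPred fun ts : List E.Transition =>
      ∃ q ∈ E.accept, E.follow (some E.start) ts = some q := by
    have hf : Primrec fun ts : List E.Transition => E.follow (some E.start) ts :=
      Primrec.list_foldl Primrec.id (Primrec.const _)
        ((Primrec.dom_finite fun p : Option Q × E.Transition =>
          if p.1 = some p.2.1.1 then some p.2.1.2.2.1 else none).comp Primrec.snd).to₂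
    have ha : PrimrecPred fun o : Option Q => ∃ q ∈ E.accept, o = some q :=
      ⟨inferInstance, Primrec.dom_finite _⟩
    exact ha.comp hf
  have hword : PrimrecPred fun p : List (Fin k) × List E.Transition =>
      p.2.filterMap (fun t => t.1.2.1.map e) = p.1 :=
    Primrec.eq.comp (Primrec.listFilterMap Primrec.snd
      ((Primrec.dom_finite fun t : E.Transition => t.1.2.1.map e).comp Primrec.snd).to₂)
      Primrec.fst
  have hprod := primrecPred_prod_eq_one fun t : E.Transition => t.1.2.2.2
  let P (w : List (Fin k)) (ts : List E.Transition) : Prop :=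
    (∃ q ∈ E.accept, E.follow (some E.start) ts = some q) ∧
      ts.filterMap (fun t => t.1.2.1.map e) = w ∧ (ts.map fun t => t.1.2.2.2).prod = 1
  have h : PrimrecPred fun p : List (Fin k) × List E.Transition => P p.1 p.2 :=
    (hpath.comp Primrec.snd).and (hword.and (hprod.comp Primrec.snd))
  refine (REPred.exists_of_primrecPred h).of_eq fun w => ?_
  rw [GroupAutomaton.mem_recognized_iff]
  simp only [GroupAutomaton.run_iff_exists_follow]
  have hw (ts : List E.Transition) : ts.filterMap (fun t => t.1.2.1.map e) = w ↔
      ts.filterMap (fun t => t.1.2.1) = w.map e.symm := by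
    rw [← List.map_filterMap]
    constructor
    · rintro rfl
      simp
    · intro h
      simp [h]
  simp only [P, hw]
  constructor
  · rintro ⟨ts, ⟨q, hq, h1⟩, h2⟩
    exact ⟨q, hq, ts, h1, h2⟩
  · rintro ⟨q, hq, ts, h1, h2⟩
    exact ⟨ts, ⟨q, hq, h1⟩, h2⟩

/-! ### Recursively enumerable languages as domains of codes on lists -/

section CodeForLanguage

open Turing.ToPartrec

theorem Turing.ToPartrec.Code.comp_eval_of {f g : Code} {v u : List ℕ}
    (hg : g.eval v = Part.some u) : (Code.comp f g).eval v = f.eval u := by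
  rw [Code.comp_eval]
  exact (congrArg (fun x => Part.bind x f.eval) hg).trans (Part.bind_some _ _)

theorem Turing.ToPartrec.Code.cons_eval_of {f g : Code} {v a b : List ℕ}
    (hf : f.eval v = Part.some a) (hg : g.eval v = Part.some b) :
    (Code.cons f g).eval v = Part.some (a.headI :: b) := by
  simp [hf, hg]

theorem exists_code_of_natPartrec {f : ℕ →. ℕ} (hf : Nat.Partrec f) :
    ∃ c : Code, ∀ n, c.eval [n] = (f n).map fun m => [m] := by
  obtain ⟨c, hc⟩ := Code.exists_code (Nat.Partrec'.part_iff₁.2 (Partrec.nat_iff.2 hf))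
  exact ⟨c, fun n => hc ⟨[n], rfl⟩⟩

theorem exists_code_of_primrec₂ {g : ℕ → ℕ → ℕ} (hg : Primrec₂ g) :
    ∃ c : Code, ∀ a b, c.eval [a, b] = Part.some [g a b] := by
  obtain ⟨c, hc⟩ := Code.exists_code (Nat.Partrec'.part_iff₂.2 hg.to_comp.partrec₂)
  refine ⟨c, fun a b => (hc ⟨[a, b], rfl⟩).trans ?_⟩
  exact Part.map_some _ _

/-- One round of consuming the second entry of a list and combining it with the first one by the
code `c`. The consumed entry is the continuation flag of `Code.fix`. -/
def foldBody (c : Code) : Code :=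
  .cons (.comp .head .tail)
    (.cons (.comp c (.cons .head (.cons (.comp .head .tail) .nil))) (.comp .tail .tail))

theorem foldBody_eval {c : Code} {g : ℕ → ℕ → ℕ} (hc : ∀ a b, c.eval [a, b] = Part.some [g a b])
    (v : List ℕ) : (foldBody c).eval v =
      Part.some (v.tail.headI :: g v.headI v.tail.headI :: v.tail.tail) := by
  have ht : Code.tail.eval v = Part.some v.tail := by simp
  have h1 : (Code.comp .head .tail).eval v = Part.some [v.tail.headI] := by
    rw [Code.comp_eval_of ht]
    simp
  have h2 : (Code.comp .tail .tail).eval v = Part.some v.tail.tail := by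
    rw [Code.comp_eval_of ht]
    simp
  have h3 : (Code.cons .head (.cons (.comp .head .tail) .nil)).eval v =
      Part.some [v.headI, v.tail.headI] :=
    Code.cons_eval_of (a := [v.headI]) (by simp)
      (Code.cons_eval_of (a := [v.tail.headI]) h1 (by simp))
  exact Code.cons_eval_of (a := [v.tail.headI]) h1
    (Code.cons_eval_of (a := [g v.headI v.tail.headI]) ((Code.comp_eval_of h3).trans (hc _ _)) h2)

theorem fix_foldBody_eval {c : Code} {g : ℕ → ℕ → ℕ}
    (hc : ∀ a b, c.eval [a, b] = Part.some [g a b]) (h0 : ∀ a, g a 0 = a) (ds : List ℕ)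
    (hds : ∀ d ∈ ds, d ≠ 0) (acc : ℕ) :
    (Code.fix (foldBody c)).eval (acc :: ds) = Part.some [ds.foldl g acc] := by
  induction ds generalizing acc with
  | nil =>
    rw [Code.fix_eval, Part.eq_some_iff]
    -- The body runs once more on the exhausted list: the default head 0 is both the stop flag and
    -- the digit passed to `g`, which is why `g a 0 = a` is needed.
    refine PFun.fix_stop ?_
    rw [foldBody_eval hc]
    simp [h0]
  | cons d ds ih =>
    rw [List.foldl_cons, ← ih (fun d hd => hds d (List.mem_cons_of_mem _ hd)), Code.fix_eval]
    refine PFun.fix_fwd_eq ?_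
    rw [foldBody_eval hc]
    simp [hds d List.mem_cons_self]

/-- Add a digit in front of an encoded list; the digit `0` is ignored. -/
def consDigit (acc d : ℕ) : ℕ :=
  Nat.casesOn d acc fun d => Nat.succ (Nat.pair d acc)

theorem primrec_consDigit : Primrec₂ consDigit :=
  Primrec.nat_casesOn Primrec.snd Primrec.fst
    (Primrec.succ.comp (Primrec₂.natPair.comp Primrec.snd (Primrec.fst.comp Primrec.fst))).to₂

theorem foldl_consDigit {α : Type*} [Encodable α] (w l : List α) :
    (w.map fun a => Encodable.encode a + 1).foldl consDigit (Encodable.encode l) =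
      Encodable.encode (w.reverse ++ l) := by
  induction w generalizing l with
  | nil => rfl
  | cons a w ih =>
    rw [List.map_cons, List.foldl_cons, List.reverse_cons, List.append_assoc,
      List.singleton_append, ← ih]
    rfl

/-- The loop packs the list of digits into a single number, on which a code for a unary partial
recursive function is run. Letters are shifted by 1 because the digit 0 ends the loop. -/
theorem REPred.exists_code {α : Type*} [Primcodable α] {p : List α → Prop} (hp : REPred p) :
    ∃ c : Code, ∀ w : List α, (c.eval (w.map fun a => Encodable.encode a + 1)).Dom ↔ p w := by
  -- The fold prepends each digit and so reverses the word; the predicate is reversed to compensate.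
  have hr : Partrec fun w : List α => Part.assert (p w.reverse) fun _ => Part.some () :=
    Partrec.comp hp Primrec.list_reverse.to_comp
  obtain ⟨c₀, h₀⟩ := exists_code_of_natPartrec hr
  obtain ⟨c₁, h₁⟩ := exists_code_of_primrec₂ primrec_consDigit
  refine ⟨.comp c₀ (.comp (.fix (foldBody c₁)) .zero'), fun w => ?_⟩
  have hf := fix_foldBody_eval h₁ (fun _ => rfl) (w.map fun a => Encodable.encode a + 1)
    (by simp) (Encodable.encode ([] : List α))
  rw [foldl_consDigit, List.append_nil] at hf
  have h : (Code.comp c₀ (.comp (.fix (foldBody c₁)) .zero')).eval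
      (w.map fun a => Encodable.encode a + 1) = c₀.eval [Encodable.encode w.reverse] := by
    have hz : Code.zero'.eval (w.map fun a => Encodable.encode a + 1) =
        Part.some (Encodable.encode ([] : List α) :: w.map fun a => Encodable.encode a + 1) := by
      simp
    exact Code.comp_eval_of ((Code.comp_eval_of hz).trans hf)
  rw [h, h₀]
  simp [Encodable.encodek, Part.assert]

end CodeForLanguage

/-! ### Free monoids inside F₂ -/

section FreeMonoidInFreeGroup

theorem FreeGroup.mk_injOn_positive {α : Type*} :
    Set.InjOn (FreeGroup.mk : List (α × Bool) → FreeGroup α) {L | ∀ p ∈ L, p.2 = true} := by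
  have key (L L' : List (α × Bool)) (hL : ∀ p ∈ L, p.2 = true) (h : FreeGroup.Red L L') :
      L' = L := by
    rcases Relation.ReflTransGen.cases_head h with h | ⟨L₁, h, -⟩
    · exact h.symm
    · cases h with
      | @not L₁ L₂ x b =>
        have h1 := hL (x, b) (by simp)
        have h2 := hL (x, !b) (by simp)
        simp_all
  intro L₁ h₁ L₂ h₂ h
  obtain ⟨L, hL₁, hL₂⟩ := FreeGroup.Red.exact.1 h
  exact (key L₁ L h₁ hL₁).symm.trans (key L₂ L h₂ hL₂)

theorem List.replicate_append_cons_inj {α : Type*} {a b : α} (hab : a ≠ b) :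
    ∀ {i j : ℕ} {r s : List α}, List.replicate i a ++ b :: r = List.replicate j a ++ b :: s →
      i = j ∧ r = s
  | 0, 0, _, _, h => by simpa using h
  | 0, j + 1, _, _, h => by simp [List.replicate_succ, hab.symm] at h
  | i + 1, 0, _, _, h => by simp [List.replicate_succ, hab] at h
  | i + 1, j + 1, _, _, h => by
    simp only [List.replicate_succ, List.cons_append, List.cons.injEq, true_and] at h
    have := List.replicate_append_cons_inj hab h
    exact ⟨congrArg (· + 1) this.1, this.2⟩

/-- The letter numbered `i` is sent to `aⁱb`. The letter `b` marks the end of each code word, so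
concatenations decode uniquely. -/
theorem exists_free_in_freeGroup (Γ : Type*) [Finite Γ] :
    ∃ x : Γ → FreeGroup (Fin 2), Function.Injective fun u : List Γ => (u.map x).prod := by
  obtain ⟨n, ⟨e⟩⟩ := Finite.exists_equiv_fin Γ
  let word (c : Γ) : List (Fin 2 × Bool) := List.replicate (e c) (0, true) ++ [(1, true)]
  have hword (u : List Γ) : (u.map fun c => FreeGroup.mk (word c)).prod =
      FreeGroup.mk (u.flatMap word) := by
    induction u with
    | nil => rfl
    | cons c u ih => rw [List.map_cons, List.prod_cons, ih, FreeGroup.mul_mk, List.flatMap_cons]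
  have hpos (u : List Γ) : ∀ p ∈ u.flatMap word, p.2 = true := by
    intro p hp
    simp only [List.mem_flatMap, word, List.mem_append, List.mem_replicate, List.mem_singleton]
      at hp
    obtain ⟨c, -, ⟨-, rfl⟩ | rfl⟩ := hp <;> rfl
  refine ⟨fun c => FreeGroup.mk (word c), fun u v h => ?_⟩
  simp only [hword] at h
  replace h := FreeGroup.mk_injOn_positive (hpos u) (hpos v) h
  induction u generalizing v with
  | nil =>
    cases v with
    | nil => rfl
    | cons d v => simp [word] at h
  | cons c u ih =>
    cases v with
    | nil => simp [word] at h
    | cons d v =>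
      simp only [List.flatMap_cons, word, List.append_assoc, List.singleton_append] at h
      obtain ⟨h1, h2⟩ := List.replicate_append_cons_inj (by simp) h
      rw [ih _ h2, e.injective (Fin.ext h1)]

end FreeMonoidInFreeGroup

/-! ### Pair automata and their translation to F₂ × F₂ -/

/-- A finite automaton whose transitions read at most one letter and are labelled by two words
over `Γ`, both written to separate output tapes. -/
structure PairAutomaton (Γ A S : Type*) where
  step : S → Option A → Set (S × List Γ × List Γ)
  start : S
  accept : Set S

namespace PairAutomaton

variable {Γ A S : Type*}

/-- `M.Run s w u v s'`: some path leads from `s` to `s'`, reads `w`, and outputs `u` and `v`. -/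
inductive Run (M : PairAutomaton Γ A S) : S → List A → List Γ → List Γ → S → Prop
  | refl (s : S) : Run M s [] [] [] s
  | step {s s₁ s' : S} {o : Option A} {a b u v : List Γ} {w : List A}
      (h : (s₁, a, b) ∈ M.step s o) (hr : Run M s₁ w u v s') :
      Run M s (o.toList ++ w) (a ++ u) (b ++ v) s'

/-- The words read along a path from the start to an accepting state with equal outputs. -/
def language (M : PairAutomaton Γ A S) : Language A :=
  {w | ∃ t ∈ M.accept, ∃ u, M.Run M.start w u u t}

/-- Restriction to a set of states. -/
def restrict (M : PairAutomaton Γ A S) (T : Set S) (h : M.start ∈ T) : PairAutomaton Γ A T where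
  step s o := {p | (p.1.1, p.2) ∈ M.step s o}
  start := ⟨M.start, h⟩
  accept := {s | s.1 ∈ M.accept}

theorem run_restrict_iff {M : PairAutomaton Γ A S} {T : Set S} {h : M.start ∈ T}
    (hT : ∀ s ∈ T, ∀ o, ∀ p ∈ M.step s o, p.1 ∈ T) {s : T} {t : S} {w : List A} {u v : List Γ} :
    (∃ ht : t ∈ T, (M.restrict T h).Run s w u v ⟨t, ht⟩) ↔ M.Run s w u v t := by
  constructor
  · rintro ⟨ht, hr⟩
    generalize hs' : (⟨t, ht⟩ : T) = s' at hr
    induction hr with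
    | refl s => subst hs'; exact Run.refl t
    | step h _ ih => exact Run.step h (ih hs')
  · obtain ⟨s, hs⟩ := s
    intro hr
    change M.Run s w u v t at hr
    induction hr with
    | refl s => exact ⟨hs, Run.refl _⟩
    | step h _ ih =>
      obtain ⟨ht, hr⟩ := ih (hT _ hs _ _ h)
      exact ⟨ht, Run.step (s₁ := (⟨_, hT _ hs _ _ h⟩ : T)) h hr⟩

/-- The simulation below has an a priori infinite state type; this cuts it down to a finite set
closed under transitions. -/
theorem language_restrict {M : PairAutomaton Γ A S} {T : Set S} (h : M.start ∈ T)
    (hT : ∀ s ∈ T, ∀ o, ∀ p ∈ M.step s o, p.1 ∈ T) :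
    (M.restrict T h).language = M.language := by
  ext w
  constructor
  · rintro ⟨t, ht, u, hr⟩
    exact ⟨t, ht, u, (run_restrict_iff hT).1 ⟨t.2, hr⟩⟩
  · rintro ⟨t, ht, u, hr⟩
    obtain ⟨htT, hr⟩ := (run_restrict_iff (s := ⟨M.start, h⟩) hT).2 hr
    exact ⟨⟨t, htT⟩, ht, u, hr⟩

section ToGroup

variable {G : Type*} [Group G] (x : Γ → G)

/-- The group automaton that computes both output words of a pair automaton in its register. In
the additional state `none` it multiplies by the inverse of a common word, letter by letter. -/
noncomputable def toGroupAutomaton [Finite Γ] (M : PairAutomaton Γ A S)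
    (hM : ∀ s o, (M.step s o).Finite) : GroupAutomaton (G × G) A (Option S) where
  step
    | none, none => (Set.finite_range fun c => (none, ((x c)⁻¹, (x c)⁻¹))).toFinset
    | none, some _ => ∅
    | some s, o => ((hM s o).image fun p =>
        (some p.1, ((p.2.1.map x).prod, (p.2.2.map x).prod))).union
        ((Set.finite_singleton (none, 1)).sep fun _ => o = none ∧ s ∈ M.accept)
        |>.toFinset
  start := some M.start
  accept := {none}

variable {x} [Finite Γ] {M : PairAutomaton Γ A S} {hM : ∀ s o, (M.step s o).Finite}

theorem run_toGroupAutomaton_none {w : List A} {g : G × G} :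
    (M.toGroupAutomaton x hM).Run none w g none ↔
      w = [] ∧ ∃ z : List Γ, g = ((z.map x).prod⁻¹, (z.map x).prod⁻¹) := by
  constructor
  · intro h
    suffices H : ∀ p q, (M.toGroupAutomaton x hM).Run p w g q → p = none →
        w = [] ∧ ∃ z : List Γ, g = ((z.map x).prod⁻¹, (z.map x).prod⁻¹) from H _ _ h rfl
    clear h
    intro p q h hp
    induction h with
    | refl p => exact ⟨rfl, [], by simp [Prod.one_eq_mk]⟩
    | @step q q₁ q' o m g w h _ ih =>
      subst hp
      cases o with
      | some a => simp [toGroupAutomaton] at h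
      | none =>
        simp only [toGroupAutomaton, Set.Finite.mem_toFinset, Set.mem_range, Prod.mk.injEq] at h
        obtain ⟨c, rfl, rfl⟩ := h
        obtain ⟨rfl, z, rfl⟩ := ih rfl
        -- Inversion reverses the order, so the letter cancelled first is the last one of the
        -- guessed word.
        exact ⟨rfl, z ++ [c], by simp⟩
  · rintro ⟨rfl, z, rfl⟩
    induction z using List.reverseRecOn with
    | nil =>
      rw [List.map_nil, List.prod_nil, inv_one]
      exact GroupAutomaton.Run.refl _
    | append_singleton z c ih =>
      have h : ((none : Option S), ((x c)⁻¹, (x c)⁻¹)) ∈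
          (M.toGroupAutomaton x hM).step none none := by
        simp [toGroupAutomaton]
      simpa using GroupAutomaton.Run.step h ih

theorem run_toGroupAutomaton {s : S} {w : List A} {g : G × G} :
    (M.toGroupAutomaton x hM).Run (some s) w g none ↔
      ∃ t ∈ M.accept, ∃ u v z : List Γ, M.Run s w u v t ∧
        g = ((u.map x).prod * (z.map x).prod⁻¹, (v.map x).prod * (z.map x).prod⁻¹) := by
  constructor
  · intro h
    generalize hp : some s = p at h
    generalize hq : (none : Option S) = q at h
    induction h generalizing s with
    | refl p => subst hp; cases hq
    | @step q q₁ q' o m g w h hr ih =>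
      subst hp hq
      simp only [toGroupAutomaton, Set.Finite.mem_toFinset] at h
      rcases h with ⟨⟨s₁, a, b⟩, h, heq⟩ | ⟨heq, rfl, hs⟩
      · simp only [Prod.mk.injEq] at heq
        obtain ⟨rfl, rfl⟩ := heq
        obtain ⟨t, ht, u, v, z, hr', rfl⟩ := ih rfl rfl
        exact ⟨t, ht, a ++ u, b ++ v, z, Run.step h hr', by simp [mul_assoc]⟩
      · simp only [Set.mem_singleton_iff, Prod.mk.injEq] at heq
        obtain ⟨rfl, rfl⟩ := heq
        obtain ⟨rfl, z, rfl⟩ := run_toGroupAutomaton_none.1 hr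
        exact ⟨s, hs, [], [], z, Run.refl s, by simp⟩
  · rintro ⟨t, ht, u, v, z, hr, rfl⟩
    induction hr with
    | refl s =>
      have h : ((none : Option S), (1 : G × G)) ∈
          (M.toGroupAutomaton x hM).step (some s) none := by
        simp only [toGroupAutomaton, Set.Finite.mem_toFinset]
        exact Or.inr ⟨rfl, trivial, ht⟩
      simpa using GroupAutomaton.Run.step h (run_toGroupAutomaton_none.2 ⟨rfl, z, rfl⟩)
    | @step s s₁ s' o a b u v w h _ ih =>
      have h : (some s₁, ((a.map x).prod, (b.map x).prod)) ∈
          (M.toGroupAutomaton x hM).step (some s) o := by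
        simp only [toGroupAutomaton, Set.Finite.mem_toFinset]
        exact Or.inl ⟨_, h, rfl⟩
      simpa [mul_assoc] using GroupAutomaton.Run.step h (ih ht)

/-- The final register is `(u z⁻¹, v z⁻¹)` for a guessed word `z`; by freeness it is trivial exactly
when `u = z = v`. -/
theorem recognized_toGroupAutomaton (hx : Function.Injective fun u : List Γ => (u.map x).prod) :
    (M.toGroupAutomaton x hM).recognized = M.language := by
  ext w
  have h1 (u v z : List Γ) :
      (1 : G × G) = ((u.map x).prod * (z.map x).prod⁻¹, (v.map x).prod * (z.map x).prod⁻¹) ↔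
        u = z ∧ v = z := by
    rw [eq_comm, Prod.ext_iff]
    simp only [Prod.fst_one, Prod.snd_one, mul_inv_eq_one]
    exact and_congr hx.eq_iff hx.eq_iff
  rw [GroupAutomaton.mem_recognized_iff]
  change (∃ q ∈ ({none} : Set (Option S)), _) ↔ _
  simp only [Set.mem_singleton_iff, exists_eq_left]
  refine run_toGroupAutomaton.trans ?_
  simp only [h1]
  constructor
  · rintro ⟨t, ht, u, v, z, hr, rfl, rfl⟩
    exact ⟨t, ht, _, hr⟩
  · rintro ⟨t, ht, u, hr⟩
    exact ⟨t, ht, u, u, u, hr, rfl, rfl⟩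

end ToGroup

theorem language_mem_groupAutomatonLanguages [Finite Γ] {S : Type}
    (M : PairAutomaton Γ A S) (hM : ∀ s o, (M.step s o).Finite) (T : Set S) (hT : T.Finite)
    (hstart : M.start ∈ T) (hstep : ∀ s ∈ T, ∀ o, ∀ p ∈ M.step s o, p.1 ∈ T) :
    M.language ∈ groupAutomatonLanguages (FreeGroup (Fin 2) × FreeGroup (Fin 2)) A := by
  obtain ⟨x, hx⟩ := exists_free_in_freeGroup Γ
  have := hT.to_subtype
  have hfin (s : T) (o : Option A) : ((M.restrict T hstart).step s o).Finite := by
    refine (hM s o).preimage (f := fun p : T × List Γ × List Γ => (p.1.1, p.2)) ?_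
    rintro ⟨⟨s, hs⟩, p⟩ - ⟨⟨s', hs'⟩, p'⟩ - heq
    simpa using heq
  exact ⟨Option T, inferInstance, (M.restrict T hstart).toGroupAutomaton x hfin,
    (recognized_toGroupAutomaton hx).trans (language_restrict hstart hstep)⟩

end PairAutomaton

/-! ### Simulating a four-stack machine with one queue -/

section StackMachine

open Turing Turing.PartrecToTM2

/-- A nontrivial rotation would move the leading `a` into `l₂`. -/
theorem List.eq_of_isRotated_cons {α : Type*} {a : α} {l₁ l₂ : List α} (h : (a :: l₁) ~r (a :: l₂))
    (ha : a ∉ l₂) : l₁ = l₂ := by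
  obtain ⟨n, hn, h⟩ := List.isRotated_iff_mem_map_range.1 h |> fun h => by
    simpa only [List.mem_map, List.mem_range] using h
  obtain ⟨x, y, hxy, hyx⟩ : ∃ x y, a :: l₁ = x ++ y ∧ y ++ x = a :: l₂ := by
    refine ⟨(a :: l₁).take n, (a :: l₁).drop n, (List.take_append_drop _ _).symm, ?_⟩
    rw [← h, List.rotate_eq_drop_append_take (by simp at hn ⊢; omega)]
  cases x with
  | nil => exact (List.cons.inj (hxy.trans (by simpa using hyx))).2
  | cons b x =>
    cases y with
    | nil => exact (List.cons.inj (hxy.trans (by simpa using hyx))).2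
    | cons c y =>
      simp only [List.cons_append, List.cons.injEq] at hxy hyx
      rw [← hyx.2, ← hxy.1] at ha
      simp at ha

theorem List.exists_eq_append_of_append_eq {α : Type*} {a c L X : List α} (h : c ++ X = a ++ L)
    (hl : a.length ≤ c.length) : ∃ d, c = a ++ d ∧ d ++ X = L := by
  rcases List.append_eq_append_iff.1 h with ⟨d, hd, hX⟩ | ⟨d, hd, hL⟩
  · have : d = [] := by
      rw [hd, List.length_append] at hl
      exact List.length_eq_zero_iff.1 (by omega)
    subst this
    exact ⟨[], by simpa using hd.symm, by simpa using hX⟩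
  · exact ⟨d, hd, hL.symm⟩

namespace StackMachine

theorem finite_stackName : Finite K' :=
  Finite.of_injective (fun k : K' => K'.casesOn (motive := fun _ => Fin 4) k 0 1 2 3)
    (by intro a b; cases a <;> cases b <;> simp)

/-- The cyclic successor of a stack name. -/
def next : K' → K'
  | .main => .rev
  | .rev => .aux
  | .aux => .stack
  | .stack => .main

/-- A stack, preceded by its name. -/
def block (S : K' → List Γ') (k : K') : List (K' ⊕ Γ') :=
  .inl k :: (S k).map .inr

/-- All stacks but one, in cyclic order. -/
def others (S : K' → List Γ') (k : K') : List (K' ⊕ Γ') :=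
  block S (next k) ++ (block S (next (next k)) ++ block S (next (next (next k))))

/-- The four stacks written as one word, which is to be read cyclically. -/
def ring (S : K' → List Γ') : List (K' ⊕ Γ') :=
  block S .main ++ others S .main

theorem isRotated_ring (S : K' → List Γ') (k : K') : (block S k ++ others S k) ~r ring S := by
  have h (a b c d : List (K' ⊕ Γ')) : (a ++ (b ++ (c ++ d))) ~r (b ++ (c ++ (d ++ a))) := by
    have := List.isRotated_append (l := a) (l' := b ++ (c ++ d))
    simpa using this
  cases k
  · exact List.IsRotated.refl _
  · exact (h _ _ _ _).trans ((h _ _ _ _).trans (h _ _ _ _))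
  · exact (h _ _ _ _).trans (h _ _ _ _)
  · exact h _ _ _ _

theorem others_update (S : K' → List Γ') (k : K') (l : List Γ') :
    others (Function.update S k l) k = others S k := by
  cases k <;> simp [others, block, next]

theorem block_update (S : K' → List Γ') (k : K') (l : List Γ') :
    block (Function.update S k l) k = .inl k :: l.map .inr := by
  simp [block]

theorem inl_notMem (S : K' → List Γ') (k : K') :
    (.inl k : K' ⊕ Γ') ∉ (S k).map .inr ++ others S k := by
  cases k <;> simp [others, block, next]

theorem exists_others_eq (S : K' → List Γ') (k : K') :
    ∃ l, others S k = .inl (next k) :: l := ⟨_, rfl⟩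

/-- The four markers are always present. Before halting, a transition removes at most two symbols,
so it removes only what is already in the queue and never borrows from later insertions. -/
theorem two_le_length {S : K' → List Γ'} {c : List (K' ⊕ Γ')} (h : c ~r ring S) :
    2 ≤ c.length := by
  rw [h.perm.length_eq]
  simp [ring, others, block]
  omega

/-- Each name occurs once, so seeing it at the front determines the whole queue. -/
theorem eq_of_cons_isRotated {S : K' → List Γ'} {k : K'} {c : List (K' ⊕ Γ')}
    (h : (.inl k :: c) ~r ring S) : c = (S k).map .inr ++ others S k :=
  List.eq_of_isRotated_cons (h.trans (isRotated_ring S k).symm) (inl_notMem S k)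

theorem isRotated_ring_update {S : K' → List Γ'} {k : K'} {l : List Γ'} :
    (.inl k :: (l.map .inr ++ others S k)) ~r ring (Function.update S k l) := by
  have := isRotated_ring (Function.update S k l) k
  rwa [others_update, block_update] at this

section

variable {Λ σ : Type}

/-- The control states of the simulation of a stack machine by a pair automaton. -/
inductive State (Λ σ : Type)
  | start
  | input
  | run (q : TM2.Stmt (fun _ : K' => Γ') Λ σ) (v : σ)

/-- The rewriting of the cyclic word that corresponds to one elementary statement: a transition
`(s, a, b)` leads to state `s`, removes `a` from the front and adds `b` at the end. In the halting
state the word is erased. -/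
def rules (M : Λ → TM2.Stmt (fun _ : K' => Γ') Λ σ) :
    TM2.Stmt (fun _ : K' => Γ') Λ σ → σ → Set (State Λ σ × List (K' ⊕ Γ') × List (K' ⊕ Γ'))
  | .push k f q, v => {(.run q v, [.inl k], [.inl k, .inr (f v)])}
  | .peek k f q, v =>
    {(.run q (f v none), [.inl k, .inl (next k)], [.inl k, .inl (next k)])} ∪
      Set.range fun a => (.run q (f v (some a)), [.inl k, .inr a], [.inl k, .inr a])
  | .pop k f q, v =>
    {(.run q (f v none), [.inl k, .inl (next k)], [.inl k, .inl (next k)])} ∪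
      Set.range fun a => (.run q (f v (some a)), [.inl k, .inr a], [.inl k])
  | .load f q, v => {(.run q (f v), [], [])}
  | .branch f q₁ q₂, v => {(.run (cond (f v) q₁ q₂) v, [], [])}
  | .goto f, v => {(.run (M (f v)) v, [], [])}
  | .halt, v => Set.range fun x => (.run .halt v, [x], [])

/-- The pair automaton that dequeues on its first tape and enqueues on its second tape, and
simulates the stack machine `M` on the cyclic word of its four stacks. Initially it writes the input
word, encoded letter by letter, to the main stack. -/
def simulation {A : Type*} (M : Λ → TM2.Stmt (fun _ : K' => Γ') Λ σ) (code : A → List Γ') (l : Λ)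
    (v : σ) : PairAutomaton (K' ⊕ Γ') A (State Λ σ) where
  step
    | .start, none => {(.input, [], [.inl .main])}
    | .input, some a => {(.input, [], (code a).map .inr)}
    | .input, none => {(.run (M l) v, [], [.inl .rev, .inl .aux, .inl .stack])}
    | .run q v, none => rules M q v ∪ Set.range fun x => (.run q v, [x], [x])
    | _, _ => ∅
  start := .start
  accept := Set.range fun v => .run .halt v

variable {A : Type*} {M : Λ → TM2.Stmt (fun _ : K' => Γ') Λ σ} {code : A → List Γ'} {l₀ : Λ}
  {v₀ : σ}

theorem finite_step (s : State Λ σ) (o : Option A) :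
    ((simulation M code l₀ v₀).step s o).Finite := by
  have : Finite K' := finite_stackName
  rcases s with _ | _ | ⟨q, v⟩ <;> cases o
  all_goals try exact Set.finite_singleton _
  all_goals try exact Set.finite_empty
  refine Set.Finite.union ?_ (Set.finite_range _)
  cases q
  case push | load | branch | goto => exact Set.finite_singleton _
  case peek | pop => exact (Set.finite_singleton _).union (Set.finite_range _)
  case halt => exact Set.finite_range _

theorem exists_run_of_mem_rules {q : TM2.Stmt (fun _ : K' => Γ') Λ σ} {v : σ}
    {p : State Λ σ × List (K' ⊕ Γ') × List (K' ⊕ Γ')} (h : p ∈ rules M q v) :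
    ∃ q' v', p.1 = .run q' v' ∧
      ((∃ f : σ → Λ, q = .goto f ∧ q' = M (f v)) ∨ q' ∈ TM2.stmts₁ q) := by
  cases q with
  | peek | pop =>
    rcases h with rfl | ⟨x, rfl⟩ <;> exact ⟨_, _, rfl, .inr (by simp [TM2.stmts₁, TM2.stmts₁_self])⟩
  | push | load => cases h; exact ⟨_, _, rfl, .inr (by simp [TM2.stmts₁, TM2.stmts₁_self])⟩
  | branch f =>
    cases h
    refine ⟨_, _, rfl, .inr ?_⟩
    cases f v <;> simp [TM2.stmts₁, TM2.stmts₁_self]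
  | goto f => cases h; exact ⟨_, _, rfl, .inl ⟨f, rfl, rfl⟩⟩
  | halt => obtain ⟨x, rfl⟩ := h; exact ⟨_, _, rfl, .inr TM2.stmts₁_self⟩

theorem eq_nil_of_run {s t : State Λ σ} {w : List A} {L R : List (K' ⊕ Γ')}
    (h : (simulation M code l₀ v₀).Run s w L R t) {q : TM2.Stmt (fun _ : K' => Γ') Λ σ} {v : σ}
    (hs : s = .run q v) : w = [] := by
  induction h generalizing q v with
  | refl s => rfl
  | @step s s₁ t o a b L R w h hr ih =>
    subst hs
    cases o with
    | some _ => cases h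
    | none =>
      rcases h with h | ⟨x, h⟩
      · obtain ⟨q', v', h', -⟩ := exists_run_of_mem_rules h
        exact ih h'
      · cases h
        exact ih rfl

/-- Soundness. The invariant is `c ++ R = L`: the current queue followed by all future insertions is
the word of all future removals. Since `c` stays a rotation of the ring of stacks, each rule that
fires is the true machine operation. Once `halt` is reached nothing remains to be checked. -/
theorem dom_of_run {s t : State Λ σ} {w : List A} {L R : List (K' ⊕ Γ')}
    (h : (simulation M code l₀ v₀).Run s w L R t) (ht : t ∈ (simulation M code l₀ v₀).accept)
    {q : TM2.Stmt (fun _ : K' => Γ') Λ σ} {v : σ} (hs : s = .run q v) {S : K' → List Γ'}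
    {c : List (K' ⊕ Γ')} (hc : c ~r ring S) (hL : c ++ R = L) :
    (StateTransition.eval (TM2.step M) (TM2.stepAux q v S)).Dom := by
  have hhalt (v : σ) (S : K' → List Γ') :
      (StateTransition.eval (TM2.step M) (TM2.stepAux .halt v S)).Dom :=
    Part.dom_iff_mem.2 ⟨_, StateTransition.mem_eval.2 ⟨.refl, rfl⟩⟩
  induction h generalizing q v S c with
  | refl s =>
    subst hs
    obtain ⟨v', hv'⟩ := ht
    cases hv'
    exact hhalt _ _
  | @step s s₁ t o a b L R w h hr ih =>
    subst hs
    cases o with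
    | some _ => cases h
    | none =>
      have hlen := two_le_length hc
      have hsplit (hl : a.length ≤ 2) : ∃ d, c = a ++ d ∧ (d ++ b) ++ R = L := by
        obtain ⟨d, h1, h2⟩ := List.exists_eq_append_of_append_eq hL (hl.trans hlen)
        exact ⟨d, h1, by simpa using h2⟩
      rcases h with h | ⟨x, h⟩
      · cases q with
        | push k f q =>
          cases h
          obtain ⟨d, rfl, hd⟩ := hsplit (by simp)
          obtain rfl := eq_of_cons_isRotated hc
          refine ih ht rfl (List.isRotated_append.trans ?_) hd
          exact isRotated_ring_update (S := S) (k := k) (l := f v :: S k)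
        | peek k f q =>
          rcases h with h | ⟨x, h⟩
          · cases h
            obtain ⟨d, rfl, hd⟩ := hsplit (by simp)
            -- The next marker directly behind `k` certifies that stack `k` is empty.
            have hS := eq_of_cons_isRotated hc
            cases hk : S k with
            | cons y l => simp [hk] at hS
            | nil =>
              have := ih ht rfl (List.isRotated_append.trans hc) hd
              rwa [TM2.stepAux, hk]
          · cases h
            obtain ⟨d, rfl, hd⟩ := hsplit (by simp)
            have hS := eq_of_cons_isRotated hc
            cases hk : S k with
            | nil => obtain ⟨l, hl⟩ := exists_others_eq S k; simp [hk, hl] at hS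
            | cons y l =>
              simp only [hk, List.map_cons, List.cons_append] at hS
              obtain ⟨rfl, -⟩ := hS
              have := ih ht rfl (List.isRotated_append.trans hc) hd
              rwa [TM2.stepAux, hk]
        | pop k f q =>
          rcases h with h | ⟨x, h⟩
          · cases h
            obtain ⟨d, rfl, hd⟩ := hsplit (by simp)
            have hS := eq_of_cons_isRotated hc
            cases hk : S k with
            | cons y l => simp [hk] at hS
            | nil =>
              have := ih ht rfl (List.isRotated_append.trans hc) hd
              rw [TM2.stepAux, hk, List.tail_nil, ← hk, Function.update_eq_self, hk]
              exact this
          · cases h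
            obtain ⟨d, rfl, hd⟩ := hsplit (by simp)
            have hS := eq_of_cons_isRotated hc
            cases hk : S k with
            | nil => obtain ⟨l, hl⟩ := exists_others_eq S k; simp [hk, hl] at hS
            | cons y l =>
              simp only [hk, List.map_cons, List.cons_append] at hS
              obtain ⟨rfl, rfl⟩ := hS
              have := ih ht rfl (List.isRotated_append.trans
                (isRotated_ring_update (S := S) (k := k) (l := l))) hd
              rwa [TM2.stepAux, hk]
        | load f q =>
          cases h
          exact ih ht rfl hc hL
        | branch f q₁ q₂ =>
          cases h
          have := ih ht rfl hc hL
          rw [TM2.stepAux]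
          cases hf : f v <;> simpa [hf] using this
        | goto f =>
          cases h
          have := ih ht rfl hc hL
          -- One `TM2.step` executes a whole statement up to its `goto`, so only here does the
          -- machine take a new step.
          rwa [StateTransition.reaches_eval (f := TM2.step M)
            (b := TM2.stepAux (M (f v)) v S) (Relation.ReflTransGen.single rfl)]
        | halt => exact hhalt _ _
      · cases h
        obtain ⟨d, rfl, hd⟩ := hsplit (by simp)
        exact ih ht rfl (List.isRotated_append.trans hc) hd

/-- From the control state `(q, v)` and the queue `c`, the simulation can reach a halting state and
an empty queue. -/
def Accepts (M : Λ → TM2.Stmt (fun _ : K' => Γ') Λ σ) (code : A → List Γ') (l₀ : Λ) (v₀ : σ)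
    (q : TM2.Stmt (fun _ : K' => Γ') Λ σ) (v : σ) (c : List (K' ⊕ Γ')) : Prop :=
  ∃ R v', (simulation M code l₀ v₀).Run (.run q v) [] (c ++ R) R (.run .halt v')

theorem Accepts.of_step {q q' : TM2.Stmt (fun _ : K' => Γ') Λ σ} {v v' : σ}
    {a b c : List (K' ⊕ Γ')}
    (h : (State.run q' v', a, b) ∈ (simulation M code l₀ v₀).step (.run q v) none)
    (hc : Accepts M code l₀ v₀ q' v' (c ++ b)) : Accepts M code l₀ v₀ q v (a ++ c) := by
  obtain ⟨R, v'', hr⟩ := hc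
  exact ⟨b ++ R, v'', by simpa using PairAutomaton.Run.step h hr⟩

theorem Accepts.of_isRotated {q : TM2.Stmt (fun _ : K' => Γ') Λ σ} {v : σ}
    {c c' : List (K' ⊕ Γ')} (h : c' ~r c) (hc : Accepts M code l₀ v₀ q v c) :
    Accepts M code l₀ v₀ q v c' := by
  obtain ⟨n, rfl⟩ := h
  induction n generalizing c' with
  | zero => simpa using hc
  | succ n ih =>
    cases c' with
    | nil => simpa using hc
    | cons x c' =>
      rw [List.rotate_cons_succ] at hc
      exact Accepts.of_step (a := [x]) (b := [x]) (Or.inr ⟨x, rfl⟩) (ih hc)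

theorem accepts_halt (v : σ) (c : List (K' ⊕ Γ')) : Accepts M code l₀ v₀ .halt v c := by
  induction c with
  | nil => exact ⟨[], v, PairAutomaton.Run.refl _⟩
  | cons x c ih =>
    exact Accepts.of_step (a := [x]) (b := []) (c := c) (v' := v) (Or.inl ⟨x, rfl⟩)
      (by simpa using ih)

/-- The simulation succeeds from a configuration of the stack machine. -/
def AcceptsCfg (M : Λ → TM2.Stmt (fun _ : K' => Γ') Λ σ) (code : A → List Γ') (l₀ : Λ) (v₀ : σ)
    (d : TM2.Cfg (fun _ : K' => Γ') Λ σ) : Prop :=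
  ∀ l, d.l = some l → Accepts M code l₀ v₀ (M l) d.var (ring d.stk)

/-- Completeness: rotate until the name of the stack concerned is in front, apply the rule, and use
that the resulting queue is again a rotation of the updated ring. -/
theorem accepts_of_stepAux {q : TM2.Stmt (fun _ : K' => Γ') Λ σ} {v : σ} {S : K' → List Γ'}
    (h : AcceptsCfg M code l₀ v₀ (TM2.stepAux q v S)) : Accepts M code l₀ v₀ q v (ring S) := by
  induction q generalizing v S with
  | push k f q ih =>
    refine Accepts.of_isRotated (isRotated_ring S k).symm
      (Accepts.of_step (a := [.inl k]) (Or.inl rfl) ((ih h).of_isRotated ?_))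
    exact List.isRotated_append.trans (isRotated_ring_update (S := S) (k := k) (l := f v :: S k))
  | peek k f q ih =>
    rw [TM2.stepAux] at h
    have hr := isRotated_ring S k
    refine Accepts.of_isRotated hr.symm ?_
    rw [block] at hr ⊢
    cases hk : S k with
    | nil =>
      rw [hk] at h hr
      obtain ⟨l, hl⟩ := exists_others_eq S k
      rw [hl] at hr ⊢
      exact Accepts.of_step (a := [.inl k, .inl (next k)]) (c := l) (Or.inl (Or.inl rfl))
        ((ih h).of_isRotated (List.isRotated_append.trans hr))
    | cons a l =>
      rw [hk] at h hr
      exact Accepts.of_step (q := .peek k f q) (v := v) (q' := q) (v' := f v (some a))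
        (a := [.inl k, .inr a]) (b := [.inl k, .inr a]) (c := l.map .inr ++ others S k)
        (Or.inl (Or.inr ⟨a, rfl⟩)) ((ih h).of_isRotated (List.isRotated_append.trans hr))
  | pop k f q ih =>
    rw [TM2.stepAux] at h
    have hr := isRotated_ring S k
    refine Accepts.of_isRotated hr.symm ?_
    rw [block] at hr ⊢
    cases hk : S k with
    | nil =>
      rw [hk, List.tail_nil, ← hk, Function.update_eq_self, hk] at h
      rw [hk] at hr
      obtain ⟨l, hl⟩ := exists_others_eq S k
      rw [hl] at hr ⊢
      exact Accepts.of_step (a := [.inl k, .inl (next k)]) (c := l) (Or.inl (Or.inl rfl))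
        ((ih h).of_isRotated (List.isRotated_append.trans hr))
    | cons a l =>
      rw [hk] at h
      exact Accepts.of_step (q := .pop k f q) (v := v) (q' := q) (v' := f v (some a))
        (a := [.inl k, .inr a]) (b := [.inl k]) (c := l.map .inr ++ others S k)
        (Or.inl (Or.inr ⟨a, rfl⟩))
        ((ih h).of_isRotated (List.isRotated_append.trans isRotated_ring_update))
  | load f q ih =>
    exact Accepts.of_step (a := []) (b := []) (c := ring S) (Or.inl rfl) (by simpa using ih h)
  | branch f q₁ q₂ ih₁ ih₂ =>
    refine Accepts.of_step (a := []) (b := []) (c := ring S) (Or.inl rfl) ?_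
    rw [List.append_nil]
    rw [TM2.stepAux] at h
    cases hf : f v with
    | true => exact ih₁ (by simpa [hf] using h)
    | false => exact ih₂ (by simpa [hf] using h)
  | goto f =>
    exact Accepts.of_step (a := []) (b := []) (c := ring S) (Or.inl rfl) (by simpa using h _ rfl)
  | halt => exact accepts_halt v _

theorem acceptsCfg_of_dom {d : TM2.Cfg (fun _ : K' => Γ') Λ σ}
    (h : (StateTransition.eval (TM2.step M) d).Dom) : AcceptsCfg M code l₀ v₀ d := by
  obtain ⟨b, hb⟩ := Part.dom_iff_mem.1 h
  obtain ⟨hr, hstep⟩ := StateTransition.mem_eval.1 hb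
  clear h hb
  induction hr using Relation.ReflTransGen.head_induction_on with
  | refl =>
    intro l hl
    obtain ⟨_, v, S⟩ := b
    subst hl
    simp at hstep
  | @head a c hac _ ih =>
    intro l hl
    obtain ⟨_, v, S⟩ := a
    subst hl
    cases hac
    exact accepts_of_stepAux ih

theorem run_input_iff {w : List A} {L R : List (K' ⊕ Γ')} {v : σ} :
    (simulation M code l₀ v₀).Run .input w L R (.run .halt v) ↔
      ∃ R', R = (w.flatMap code).map .inr ++ ([.inl .rev, .inl .aux, .inl .stack] ++ R') ∧
        (simulation M code l₀ v₀).Run (.run (M l₀) v₀) [] L R' (.run .halt v) := by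
  constructor
  · intro h
    generalize hs : State.input = s at h
    generalize ht : State.run .halt v = t at h
    induction h with
    | refl s => subst hs; cases ht
    | @step s s₁ t o a b L R w h hr ih =>
      subst hs
      cases o with
      | none =>
        cases h
        obtain rfl := eq_nil_of_run hr rfl
        subst ht
        exact ⟨R, rfl, hr⟩
      | some x =>
        cases h
        obtain ⟨R', rfl, hr'⟩ := ih rfl ht
        subst ht
        exact ⟨R', by simp, hr'⟩
  · rintro ⟨R', rfl, hr⟩
    induction w with
    | nil =>
      have h : (State.run (M l₀) v₀, [], [.inl .rev, .inl .aux, .inl .stack]) ∈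
          (simulation M code l₀ v₀).step .input none := rfl
      exact PairAutomaton.Run.step h hr
    | cons x w ih =>
      have h : (State.input, [], (code x).map .inr) ∈
          (simulation M code l₀ v₀).step .input (some x) := rfl
      simpa using PairAutomaton.Run.step h ih

theorem run_start_iff {w : List A} {L R : List (K' ⊕ Γ')} {v : σ} :
    (simulation M code l₀ v₀).Run .start w L R (.run .halt v) ↔
      ∃ R', R = ring (K'.elim (w.flatMap code) [] [] []) ++ R' ∧
        (simulation M code l₀ v₀).Run (.run (M l₀) v₀) [] L R' (.run .halt v) := by
  have hring (w : List A) : ring (K'.elim (w.flatMap code) [] [] []) =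
      .inl .main :: ((w.flatMap code).map .inr ++ [.inl .rev, .inl .aux, .inl .stack]) := by
    simp [ring, others, block, next, K'.elim]
  constructor
  · intro h
    generalize hs : State.start = s at h
    generalize ht : State.run .halt v = t at h
    cases h with
    | refl s => subst hs; cases ht
    | @step _ s₁ _ o a b L R w h hr =>
      subst hs ht
      cases o with
      | some x => cases h
      | none =>
        cases h
        obtain ⟨R', rfl, hr'⟩ := run_input_iff.1 hr
        exact ⟨R', by simp [hring], hr'⟩
  · rintro ⟨R', rfl, hr⟩
    have h : (State.input, [], [.inl .main]) ∈ (simulation M code l₀ v₀).step .start none := rfl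
    rw [hring]
    simpa using PairAutomaton.Run.step h (run_input_iff.2 ⟨R', rfl, hr⟩)

theorem mem_language_simulation {w : List A} :
    w ∈ (simulation M code l₀ v₀).language ↔ (StateTransition.eval (TM2.step M)
      ⟨some l₀, v₀, K'.elim (w.flatMap code) [] [] []⟩).Dom := by
  constructor
  · rintro ⟨_, ⟨v, rfl⟩, u, h⟩
    obtain ⟨R, hR, hr⟩ := run_start_iff.1 h
    rw [StateTransition.reaches_eval (f := TM2.step M)
      (b := TM2.stepAux (M l₀) v₀ (K'.elim (w.flatMap code) [] [] []))
      (Relation.ReflTransGen.single rfl)]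
    exact dom_of_run hr ⟨v, rfl⟩ rfl (List.IsRotated.refl _) hR.symm
  · intro h
    obtain ⟨R, v, hr⟩ := acceptsCfg_of_dom (code := code) (l₀ := l₀) (v₀ := v₀) h l₀ rfl
    exact ⟨_, ⟨v, rfl⟩, _, run_start_iff.2 ⟨R, rfl, hr⟩⟩

/-- Only substatements of the statements at labels in `T` occur as control states; they are finitely
many, and the support condition makes them closed under `goto`. -/
theorem halting_mem_groupAutomatonLanguages [Finite σ] (T : Finset Λ) (hl₀ : l₀ ∈ T)
    (hT : ∀ l ∈ T, TM2.SupportsStmt T (M l)) :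
    {w : List A | (StateTransition.eval (TM2.step M)
      ⟨some l₀, v₀, K'.elim (w.flatMap code) [] [] []⟩).Dom} ∈
      groupAutomatonLanguages (FreeGroup (Fin 2) × FreeGroup (Fin 2)) A := by
  have : Finite K' := finite_stackName
  have hlang : (simulation M code l₀ v₀).language = {w : List A | (StateTransition.eval (TM2.step M)
      ⟨some l₀, v₀, K'.elim (w.flatMap code) [] [] []⟩).Dom} :=
    Set.ext fun w => mem_language_simulation
  rw [← hlang]
  let F : Set (TM2.Stmt (fun _ : K' => Γ') Λ σ) := ⋃ l ∈ T, TM2.stmts₁ (M l)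
  have hF : F.Finite := T.finite_toSet.biUnion fun l _ => Finset.finite_toSet _
  have hself (l : Λ) (hl : l ∈ T) : M l ∈ F := Set.mem_biUnion hl (TM2.stmts₁_self)
  refine (simulation M code l₀ v₀).language_mem_groupAutomatonLanguages finite_step
    ({.start, .input} ∪ Set.image2 State.run F Set.univ)
    (Set.Finite.union (Set.toFinite _) (hF.image2 _ Set.finite_univ))
    (Or.inl (Or.inl rfl)) ?_
  rintro s hs o p hp
  rcases hs with (rfl | rfl) | ⟨q, hq, v, -, rfl⟩
  · cases o <;> cases hp
    exact Or.inl (Or.inr rfl)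
  · cases o <;> cases hp
    · exact Or.inr ⟨M l₀, hself _ hl₀, v₀, trivial, rfl⟩
    · exact Or.inl (Or.inr rfl)
  · cases o with
    | some x => cases hp
    | none =>
      right
      rcases hp with hp | ⟨x, rfl⟩
      · obtain ⟨q', v', h', hq'⟩ := exists_run_of_mem_rules hp
        refine ⟨q', ?_, v', trivial, h'.symm⟩
        obtain ⟨l, hl, hq⟩ := Set.mem_iUnion₂.1 hq
        rcases hq' with ⟨f, rfl, rfl⟩ | hq'
        · exact hself _ (TM2.stmts₁_supportsStmt_mono hq (hT l hl) v)
        · exact Set.mem_biUnion hl (TM2.stmts₁_trans hq hq')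
      · exact ⟨q, hq, v, trivial, rfl⟩

end

end StackMachine

end StackMachine

/-! ### Closing the cycle of inclusions -/

open Turing.PartrecToTM2 in
theorem reLanguages_subset (A : Type*) :
    reLanguages A ⊆ groupAutomatonLanguages (FreeGroup (Fin 2) × FreeGroup (Fin 2)) A := by
  rintro L ⟨k, e, hL⟩
  obtain ⟨c, hc⟩ := hL.exists_code
  -- A digit followed by the separator is what `trList` writes for one entry, so copying the input
  -- letter by letter yields the initial main stack.
  let code (a : A) : List Γ' := trNat (Encodable.encode (e a) + 1) ++ [Γ'.cons]
  have hcode (w : List A) :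
      w.flatMap code = trList ((w.map e).map fun a => Encodable.encode a + 1) := by
    induction w with
    | nil => rfl
    | cons a w ih => simp [code, ih]
  have hsupp := tr_supports c Cont'.halt
  have h := StackMachine.halting_mem_groupAutomatonLanguages (M := tr) (code := code)
    (l₀ := trNormal c Cont'.halt) (v₀ := none) (codeSupp c Cont'.halt) hsupp.1 hsupp.2
  refine (congrArg (· ∈ groupAutomatonLanguages _ A) (Set.ext fun w => ?_)).mp h
  have := hc (w.map e)
  rw [show (w.map e).map e.symm = w by simp] at this
  refine Iff.trans ?_ this
  change (StateTransition.eval (Turing.TM2.step tr)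
    ⟨some (trNormal c Cont'.halt), none, K'.elim (w.flatMap code) [] [] []⟩).Dom ↔ _
  rw [hcode]
  exact (congrArg Part.Dom (tr_eval c _)).to_iff

theorem mainTheorem10 {A : Type*} [Finite A] :
    reLanguages A = groupAutomatonLanguages (FreeGroup (Fin 2) × FreeGroup (Fin 2)) A ∧
      ∀ n : ℕ, 4 ≤ n →
        groupAutomatonLanguages (FreeGroup (Fin 2) × FreeGroup (Fin 2)) A =
          groupAutomatonLanguages (Matrix.SpecialLinearGroup (Fin n) ℤ) A := by
  have hsub (n : ℕ) (hn : 4 ≤ n) :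
      groupAutomatonLanguages (FreeGroup (Fin 2) × FreeGroup (Fin 2)) A ⊆
        groupAutomatonLanguages (Matrix.SpecialLinearGroup (Fin n) ℤ) A := by
    obtain ⟨φ, hφ⟩ := exists_freeGroup_prod_embedding hn
    exact groupAutomatonLanguages_mono φ hφ A
  refine ⟨(reLanguages_subset A).antisymm
    ((hsub 4 le_rfl).trans (specialLinearGroup_languages_subset 4 A)), fun n hn => ?_⟩
  exact (hsub n hn).antisymm
    ((specialLinearGroup_languages_subset n A).trans (reLanguages_subset A))
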